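/- Let $\kappa,\lambda$ be cardinals with $\mathrm{cf}(\lambda)=\kappa$ and $2^{<\lambda}=\lambda$, where $2^{<\lambda}=\sup_{\mu<\lambda}2^{\mu}$. Let $P_\kappa(\lambda)=\{x\subseteq\lambda : |x|<\kappa\}$, and let $U$ be a $\kappa$-complete normal fine ultrafilter on $P_\kappa(\lambda)$; that is, $U$ is an ultrafilter such that: - ($\kappa$-complete) the intersection of fewer than $\kappa$ members of $U$ is in $U$; - (fine) $\{x\in P_\kappa(\lambda):\alpha\in x\}\in U$ for every $\alpha<\lambda$; - (normal) whenever $X_\alpha\in U$ for all $\alpha<\lambda$, the diagonal intersection $\{x\in P_\kappa(\lambda) : x\in X_\alpha \text{ for all } \alpha\in x\}$ is in $U$. For a cardinal $\mu\ge\kappa$ let $\mathrm{Gal}(U,\kappa,\mu)$ denote the statement that for every sequence $\langle A_i : i<\mu\rangle$ of sets in $U$ there is $I\subseteq\mu$ with $|I|=\kappa$ and $\bigcap_{i\in I}A_i\in U$. Then $\mathrm{Gal}(U,\kappa,\lambda^+)$ holds, and $\mathrm{Gal}(U,\kappa,2^\lambda)$ holds as well. -/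

import Mathlib

open Cardinal Order

universe u

/-- `P_κ(λ)`, the set of subsets of `λ` of cardinality less than `κ`. The cardinal `λ` is identified
with its initial ordinal, whose elements form the type `lam.ord.ToType`. -/
def PKappa (κ lam : Cardinal.{u}) : Type u :=
  {x : Set lam.ord.ToType // #x < κ}

/-- Membership of an ordinal below `λ` in an element of `P_κ(λ)`. -/
instance (κ lam : Cardinal.{u}) : Membership lam.ord.ToType (PKappa κ lam) :=
  ⟨fun x α => α ∈ x.1⟩

/-- An ultrafilter on `P_κ(λ)` is fine if it contains every cone `{x | α ∈ x}`, for `α < λ`. -/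
def IsFineUltrafilter {κ lam : Cardinal.{u}} (U : Ultrafilter (PKappa κ lam)) : Prop :=
  ∀ α : lam.ord.ToType, {x : PKappa κ lam | α ∈ x} ∈ U

/-- The diagonal intersection of a `λ`-sequence of subsets of `P_κ(λ)`. -/
def diagInter {κ lam : Cardinal.{u}} (X : lam.ord.ToType → Set (PKappa κ lam)) :
    Set (PKappa κ lam) :=
  {x | ∀ α : lam.ord.ToType, α ∈ x → x ∈ X α}

/-- An ultrafilter on `P_κ(λ)` is normal if it is closed under diagonal intersections. -/
def IsNormalUltrafilter {κ lam : Cardinal.{u}} (U : Ultrafilter (PKappa κ lam)) : Prop :=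
  ∀ X : lam.ord.ToType → Set (PKappa κ lam), (∀ α, X α ∈ U) → diagInter X ∈ U

/-- The Galvin property `Gal(F, κ, μ)`: for every sequence of `μ` sets in `F` there is a set of
exactly `κ` indices such that the intersection over these indices is in `F`. -/
def Gal {X : Type u} (F : Filter X) (κ μ : Cardinal.{u}) : Prop :=
  ∀ A : μ.ord.ToType → Set X, (∀ i, A i ∈ F) →
    ∃ I : Set μ.ord.ToType, #I = κ ∧ (⋂ i ∈ I, A i) ∈ F

/-- Otherwise the at most `c` fibers of size at most `c` would cover `ι`. -/
theorem exists_forall_lt_mk_fiber {ι τ : Type u} {σ : τ → Type u} {c : Cardinal.{u}}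
    (hc : ℵ₀ ≤ c) (hι : c < #ι) (hτ : #τ ≤ c) (hσ : ∀ t, #(σ t) ≤ c) (f : ∀ t, ι → σ t) :
    ∃ i, ∀ t, c < #{j | f t j = f t i} := by
  by_contra! h
  let small : Type u := {p : Σ t, σ t // #{j | f p.1 j = p.2} ≤ c}
  have hcover : (⋃ p : small, {j | f p.1.1 j = p.1.2}) = Set.univ := by
    refine Set.eq_univ_of_forall fun i => ?_
    obtain ⟨t, ht⟩ := h i
    exact Set.mem_iUnion.2 ⟨⟨⟨t, f t i⟩, ht⟩, rfl⟩
  have hsmall : #small ≤ c := by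
    refine (mk_subtype_le _).trans ?_
    rw [mk_sigma]
    calc Cardinal.sum (fun t => #(σ t)) ≤ Cardinal.sum (fun _ : τ => c) := sum_le_sum _ _ hσ
      _ = #τ * c := by simp
      _ ≤ c * c := by gcongr
      _ = c := mul_eq_self hc
  have : #ι ≤ c := by
    rw [← mk_univ, ← hcover]
    refine mk_iUnion_le_sum_mk.trans ?_
    calc Cardinal.sum (fun p : small => #{j | f p.1.1 j = p.1.2})
        ≤ Cardinal.sum (fun _ : small => c) := sum_le_sum _ _ fun p => p.2
      _ = #small * c := by simp
      _ ≤ c * c := by gcongr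
      _ = c := mul_eq_self hc
  exact this.not_gt hι

theorem exists_injective_forall_mem {ι τ : Type u} (H : τ → Set ι) (hH : ∀ t, #τ < #(H t)) :
    ∃ g : τ → ι, Function.Injective g ∧ ∀ t, g t ∈ H t := by
  have key (t : τ) (g : ∀ s, WellOrderingRel s t → ι) :
      ∃ i ∈ H t, ∀ s hs, g s hs ≠ i := by
    by_contra! h
    have hsub : H t ⊆ Set.range fun s : {s // WellOrderingRel s t} => g s.1 s.2 := by
      intro i hi
      obtain ⟨s, hs, rfl⟩ := h i hi
      exact ⟨⟨s, hs⟩, rfl⟩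
    exact (((mk_le_mk_of_subset hsub).trans mk_range_le).trans (mk_subtype_le _)).not_gt (hH t)
  choose F hF hne using key
  let g : τ → ι := WellOrderingRel.isWellOrder.wf.fix F
  have hg (t : τ) : g t = F t fun s _ => g s := WellOrderingRel.isWellOrder.wf.fix_eq F t
  have hlt {s t : τ} (hst : WellOrderingRel s t) : g s ≠ g t := by
    rw [hg t]
    exact hne t (fun s _ => g s) s hst
  refine ⟨g, fun s t hst => ?_, fun t => hg t ▸ hF t _⟩
  rcases trichotomous_of WellOrderingRel s t with h | h | h
  · exact absurd hst (hlt h)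
  · exact h
  · exact absurd hst.symm (hlt h)

/-- Every infinite cardinal has a cofinal subset of its initial ordinal of cardinality equal to the
cofinality, all of whose bounded parts are smaller. -/
theorem exists_set_mk_eq_cof (lam : Cardinal.{u}) (hlam : ℵ₀ ≤ lam) :
    ∃ C : Set lam.ord.ToType, #C = lam.ord.cof ∧
      ∀ α, #{c | c ∈ C ∧ c ≤ α} < lam.ord.cof := by
  obtain ⟨C, hC, htype⟩ := Ordinal.exists_ord_cof_eq lam.ord.ToType
  rw [Ordinal.cof_toType] at htype
  have hmk : #C = lam.ord.cof := by
    have := congrArg Ordinal.card htype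
    simpa using this
  refine ⟨C, hmk, fun α => ?_⟩
  have : NoMaxOrder lam.ord.ToType := Cardinal.noMaxOrder hlam
  obtain ⟨β, hαβ⟩ := exists_gt α
  obtain ⟨c, hcC, hβc⟩ := hC β
  have hlt : Ordinal.typein (α := C) (· < ·) ⟨c, hcC⟩ < lam.ord.cof.ord :=
    htype ▸ Ordinal.typein_lt_type _ _
  have hcard := Cardinal.lt_ord.1 hlt
  refine lt_of_le_of_lt ?_ hcard
  rw [Ordinal.card_typein]
  refine mk_le_of_injective
    (f := fun d : {d | d ∈ C ∧ d ≤ α} => ⟨⟨d.1, d.2.1⟩, (d.2.2.trans_lt hαβ).trans_le hβc⟩) ?_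
  intro d e h
  simpa [Subtype.ext_iff] using h

/-- Code values of `g` by `μ` bits; `U` decides each bit, and completeness decides all of them at
once. -/
theorem Ultrafilter.exists_preimage_singleton_mem {X Y : Type u} {κ μ : Cardinal.{u}}
    (U : Ultrafilter X) [CardinalInterFilter (U : Filter X) κ] (hμ : μ < κ)
    (hY : #Y ≤ 2 ^ μ) (g : X → Y) : ∃ y, g ⁻¹' {y} ∈ U := by
  induction μ using Cardinal.inductionOn with | mk ι =>
  rw [← mk_set] at hY
  obtain ⟨f⟩ := hY
  let S (i : ι) : Set X := {x | i ∈ f (g x) ↔ {x | i ∈ f (g x)} ∈ U}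
  have hS (i : ι) : S i ∈ U := by
    by_cases h : {x | i ∈ f (g x)} ∈ U
    · simp [S, h]
    · simpa [S, h, Set.compl_def] using Ultrafilter.compl_mem_iff_notMem.2 h
  have hmem : (⋂ i, S i) ∈ (U : Filter X) := (Filter.cardinal_iInter_mem hμ).2 hS
  obtain ⟨x, hx⟩ := U.nonempty_of_mem hmem
  refine ⟨g x, Filter.mem_of_superset hmem fun y hy => f.injective (Set.ext fun i => ?_)⟩
  exact (Set.mem_iInter.1 hy i).trans (Set.mem_iInter.1 hx i).symm

section

variable {κ lam : Cardinal.{u}} {U : Ultrafilter (PKappa κ lam)}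

theorem IsFineUltrafilter.aleph0_le_cof (hfine : IsFineUltrafilter U)
    (hcof : lam.ord.cof = κ) : ℵ₀ ≤ κ := by
  by_contra! h
  obtain ⟨x₀, -⟩ := U.nonempty_of_mem Filter.univ_mem
  have hpos : κ ≠ 0 := (lt_of_le_of_lt zero_le x₀.2).ne'
  have hne : Nonempty lam.ord.ToType := by
    rw [← Order.cof_ne_zero_iff, Ordinal.cof_toType, hcof]
    exact hpos
  obtain ⟨α⟩ := hne
  obtain ⟨x, hx⟩ := U.nonempty_of_mem (hfine α)
  have h1 : κ ≤ 1 := by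
    rw [← hcof] at h ⊢
    exact Ordinal.cof_lt_aleph0_iff.1 h
  have : #x.1 = 0 := Cardinal.lt_one_iff.1 (x.2.trans_le h1)
  exact (Cardinal.mk_set_eq_zero_iff.1 this ▸ hx : α ∈ (∅ : Set lam.ord.ToType))

theorem IsFineUltrafilter.lt_two_power [CardinalInterFilter (U : Filter (PKappa κ lam)) κ]
    (hfine : IsFineUltrafilter U) (hκ : κ ≤ lam) {μ : Cardinal.{u}} (hμ : μ < κ) :
    2 ^ μ < lam := by
  by_contra! h
  have key (x : PKappa κ lam) : ∃ α : lam.ord.ToType, α ∉ x := by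
    by_contra! hx
    have : #x.1 = lam := by
      rw [Set.eq_univ_of_forall (s := x.1) hx, mk_univ, mk_ord_toType]
    exact (this ▸ x.2).not_ge hκ
  -- A point missed by `x` cannot be constant on a set in `U`, by fineness.
  choose g hg using key
  obtain ⟨α, hα⟩ := U.exists_preimage_singleton_mem hμ (by simpa using h) g
  obtain ⟨x, hx, hαx⟩ := U.nonempty_of_mem (Filter.inter_mem hα (hfine α))
  exact hg x ((show g x = α from hx) ▸ hαx)

theorem IsFineUltrafilter.isStrongLimit [CardinalInterFilter (U : Filter (PKappa κ lam)) κ]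
    (hfine : IsFineUltrafilter U) (hcof : lam.ord.cof = κ)
    (hpow : (2 : Cardinal.{u}) ^< lam = lam) {μ : Cardinal.{u}} (hμ : μ < lam) :
    2 ^ μ < lam := by
  rcases lt_or_ge μ κ with h | h
  · exact hfine.lt_two_power (hcof ▸ Ordinal.cof_ord_le lam) h
  · refine lt_of_le_of_ne ((le_powerlt 2 hμ).trans_eq hpow) fun heq => ?_
    -- By König, `2 ^ μ` has cofinality above `μ ≥ κ`, so it is not `lam`.
    have := lt_cof_ord_power ((hfine.aleph0_le_cof hcof).trans h) one_lt_two
    rw [heq, hcof] at this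
    exact this.not_ge h

theorem PKappa.mk_forall_lt_le (c : lam.ord.ToType) :
    #{x : PKappa κ lam | ∀ β ∈ x, β < c} ≤ 2 ^ #(Set.Iio c) := by
  rw [← mk_set]
  refine mk_le_of_injective (f := fun x => {β : Set.Iio c | β.1 ∈ x.1}) fun x y h => ?_
  refine Subtype.ext (Subtype.ext (Set.ext fun β => ?_))
  constructor
  · intro hβ
    exact (Set.ext_iff.1 h ⟨β, x.2 β hβ⟩).1 hβ
  · intro hβ
    exact (Set.ext_iff.1 h ⟨β, y.2 β hβ⟩).2 hβ

theorem IsNormalUltrafilter.gal_succ [CardinalInterFilter (U : Filter (PKappa κ lam)) κ]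
    (hnormal : IsNormalUltrafilter U) (hfine : IsFineUltrafilter U)
    (hcof : lam.ord.cof = κ) (hpow : (2 : Cardinal.{u}) ^< lam = lam) :
    Gal (U : Filter (PKappa κ lam)) κ (succ lam) := by
  intro A hA
  have hκ : κ ≤ lam := hcof ▸ Ordinal.cof_ord_le lam
  have hlam : ℵ₀ ≤ lam := (hfine.aleph0_le_cof hcof).trans hκ
  let T (c : lam.ord.ToType) : Set (PKappa κ lam) := {x | ∀ β ∈ x, β < c}
  have htrace (c : lam.ord.ToType) : #(Set (T c)) ≤ lam := by
    rw [mk_set]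
    refine (hfine.isStrongLimit hcof hpow ?_).le
    refine (PKappa.mk_forall_lt_le c).trans_lt (hfine.isStrongLimit hcof hpow ?_)
    simpa using mk_Iio_lt c (by simp)
  obtain ⟨i₀, hi₀⟩ := exists_forall_lt_mk_fiber hlam (ι := (succ lam).ord.ToType)
    (by rw [mk_ord_toType]; exact lt_succ lam) (mk_ord_toType lam).le htrace
    fun c i => ((↑) : T c → PKappa κ lam) ⁻¹' A i
  obtain ⟨C, hC, hCα⟩ := exists_set_mk_eq_cof lam hlam
  rw [hcof] at hC hCα
  obtain ⟨g, hg, hgT⟩ := exists_injective_forall_mem _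
    fun c : C => (hC.trans_le hκ).trans_lt (hi₀ c.1)
  -- The first factor puts into `x` every point of `C` up to an element of `x`, so a point of `C`
  -- outside `x` lies strictly above `x`.
  let Y (α : lam.ord.ToType) : Set (PKappa κ lam) :=
    (⋂ c ∈ {c | c ∈ C ∧ c ≤ α}, {x | c ∈ x}) ∩ {x | ∀ h : α ∈ C, x ∈ A (g ⟨α, h⟩)}
  have hY (α : lam.ord.ToType) : Y α ∈ U := by
    refine Filter.inter_mem ((Filter.cardinal_bInter_mem (hCα α)).2 fun c _ => hfine c) ?_
    by_cases h : α ∈ C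
    · exact Filter.mem_of_superset (hA (g ⟨α, h⟩)) fun x hx _ => hx
    · exact Filter.mem_of_superset Filter.univ_mem fun x _ h' => absurd h' h
  refine ⟨Set.range g, (mk_range_eq g hg).trans hC, ?_⟩
  refine Filter.mem_of_superset (Filter.inter_mem (hnormal Y hY) (hA i₀)) ?_
  rintro x ⟨hx, hx₀⟩
  rw [Set.biInter_range]
  refine Set.mem_iInter.2 fun c => ?_
  by_cases hcx : c.1 ∈ x
  · exact (hx c.1 hcx).2 c.2
  · have hxT : x ∈ T c.1 := fun β hβ => by
      by_contra! hle
      exact hcx (Set.mem_iInter₂.1 (hx β hβ).1 c.1 ⟨c.2, hle⟩)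
    exact (Set.ext_iff.1 (hgT c) ⟨x, hxT⟩).2 hx₀

end

theorem Gal.mono {X : Type u} {F : Filter X} {κ μ ν : Cardinal.{u}} (h : Gal F κ μ)
    (hμν : μ ≤ ν) : Gal F κ ν := by
  intro A hA
  obtain ⟨f⟩ : #μ.ord.ToType ≤ #ν.ord.ToType := by simpa using hμν
  obtain ⟨I, hI, hmem⟩ := h (fun i => A (f i)) fun i => hA (f i)
  refine ⟨f '' I, (mk_image_eq f.injective).trans hI, ?_⟩
  rwa [Set.biInter_image]

theorem mainTheorem2 (κ lam : Cardinal.{u}) (hcof : lam.ord.cof = κ)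
    (hpow : (2 : Cardinal.{u}) ^< lam = lam)
    (U : Ultrafilter (PKappa κ lam))
    (hcomplete : CardinalInterFilter (U : Filter (PKappa κ lam)) κ)
    (hfine : IsFineUltrafilter U) (hnormal : IsNormalUltrafilter U) :
    Gal (U : Filter (PKappa κ lam)) κ (succ lam) ∧
      Gal (U : Filter (PKappa κ lam)) κ ((2 : Cardinal.{u}) ^ lam) := by
  have h := hnormal.gal_succ hfine hcof hpow
  exact ⟨h, h.mono (succ_le_of_lt (cantor lam))⟩
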